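/- Let $\mathcal{E}$ be a virtual equipment, i.e. a virtual double category in which every object $A$ has a unit $U_A : A ⇸ A$ (a composite of the empty string of proarrows at $A$) and every proarrow $K : A ⇸ B$ has a restriction $K(f,g) : X ⇸ Y$ along all vertical arrows $f : X \to A$, $g : Y \to B$ (the domain of a cartesian 2-cell $K(f,g) \to K$ with vertical sides $f$ and $g$). For an object $A$ of $\mathcal{E}$ let $|A|$ be the $\mathcal{E}$-enriched category whose objects are the vertical arrows $f : X \to A$, the extent of $f$ being $X$, and whose hom-proarrow from $f$ to $g$ is $|A|(f,g) = U_A(f,g)$ (equivalently, the composite of the companion of $f$ and the conjoint of $g$), with the identities and the composition induced by the unit $U_A$. For a proarrow $K : A ⇸ B$ let $|K| : |A| ⇸ |B|$ be the enriched profunctor with components $|K|(f,g) = K(f,g)$ and the left and right actions of $|A|$ and $|B|$ induced by the unit 2-cells $U_A, K \to K$ and $K, U_B \to K$. The assignment $K \mapsto |K|$ extends to a functor $|\cdot|$ from the category of proarrows $A ⇸ B$ (morphisms: 2-cells $K \to K'$ with one proarrow in the domain and with identity vertical sides) to the category of profunctors $|A| ⇸ |B|$ (morphisms: families of such 2-cells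 between the components that commute with both actions). For a profunctor $J : |A| ⇸ |B|$, consider the proarrow $J(\mathrm{id}_A,\mathrm{id}_B) : A ⇸ B$. The canonical action morphism $|J(\mathrm{id}_A,\mathrm{id}_B)| \to J$ is the morphism of profunctors whose component $J(\mathrm{id}_A,\mathrm{id}_B)(f,g) \to J(f,g)$ at $f : X \to A$, $g : Y \to B$ is obtained by letting the companion $|A|(f,\mathrm{id}_A)$ of $f$ and the conjoint $|B|(\mathrm{id}_B,g)$ of $g$ act on $J(\mathrm{id}_A,\mathrm{id}_B)$. Then, for all objects $A$, $B$ of $\mathcal{E}$ and every profunctor $J : |A| ⇸ |B|$: $J$ lies in the essential image of the functor $|\cdot|$ (i.e. $J \cong |K|$ for some proarrow $K : A ⇸ B$) if and only if the canonical action morphism $|J(\mathrm{id}_A,\mathrm{id}_B)| \to J$ is an isomorphism of profunctors. -/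

import Mathlib

open CategoryTheory

universe u v w z t t'

set_option linter.checkUnivs false

namespace VirtualDouble

/-! ## Virtual double categories -/

/-- Finite composable strings `X = X₀ ⇸ X₁ ⇸ ⋯ ⇸ X_k = Y` of proarrows (`k = 0` allowed). -/
inductive ProPath {E : Type u} (P : E → E → Type w) : E → E → Type (max u w)
  | nil (X : E) : ProPath P X X
  | cons {X Y Z : E} (J : P X Y) (Js : ProPath P Y Z) : ProPath P X Z

namespace ProPath

variable {E : Type u} {P : E → E → Type w}

/-- Concatenation of strings of proarrows. -/
@[reducible] def append : {X Y Z : E} → ProPath P X Y → ProPath P Y Z → ProPath P X Z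
  | _, _, _, nil _, Ks => Ks
  | _, _, _, cons J Js, Ks => cons J (append Js Ks)

/-- The string consisting of one proarrow. -/
abbrev one {X Y : E} (J : P X Y) : ProPath P X Y := cons J (nil Y)

/-- The string consisting of two proarrows. -/
abbrev two {X Y Z : E} (J : P X Y) (K : P Y Z) : ProPath P X Z := cons J (one K)

/-- The string consisting of three proarrows. -/
abbrev three {X Y Z W : E} (J : P X Y) (K : P Y Z) (L : P Z W) : ProPath P X W :=
  cons J (two K L)

theorem append_nil {X Y : E} (Js : ProPath P X Y) : Js.append (nil Y) = Js := by
  induction Js with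
  | nil => rfl
  | cons J Js ih => simp [append, ih]

theorem append_assoc {X Y Z W : E} (Js : ProPath P X Y) (Ks : ProPath P Y Z)
    (Ls : ProPath P Z W) : (Js.append Ks).append Ls = Js.append (Ks.append Ls) := by
  induction Js with
  | nil => rfl
  | cons J Js ih => simp [append, ih]

end ProPath

/-- The objects, vertical arrows, proarrows and 2-cells of a virtual double category:
`Cell Js f g K` is the type of 2-cells with horizontal domain the string `Js`, horizontal
codomain the proarrow `K`, and vertical sides `f` (left) and `g` (right). -/
class CellData (E : Type u) extends Category.{v} E where
  Pro : E → E → Type w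
  Cell : {X X' Y Y' : E} → ProPath Pro X X' → (X ⟶ Y) → (X' ⟶ Y') → Pro Y Y' → Type z

open CellData (Pro Cell)

/-- Finite horizontal strings of 2-cells in which consecutive 2-cells share a vertical side.
The domain is the concatenation of the domains, the codomain is the string of the codomains.
(The domain is specified through an equation, to avoid transports along equalities of strings.) -/
inductive CellPath {E : Type u} [CellData.{u, v, w, z} E] :
    {X X' Y Y' : E} → ProPath (Pro (E := E)) X X' → (X ⟶ Y) → (X' ⟶ Y') →
      ProPath (Pro (E := E)) Y Y' → Type (max u v w z)
  | nil {X Y : E} (f : X ⟶ Y) : CellPath (.nil X) f f (.nil Y)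
  | cons {X₀ X₁ X₂ Y₀ Y₁ Y₂ : E} {Js : ProPath Pro X₀ X₁} {Js' : ProPath Pro X₁ X₂}
      {Js'' : ProPath Pro X₀ X₂} {f : X₀ ⟶ Y₀} {g : X₁ ⟶ Y₁} {h : X₂ ⟶ Y₂}
      {K : Pro Y₀ Y₁} {Ks : ProPath Pro Y₁ Y₂}
      (α : Cell Js f g K) (αs : CellPath Js' g h Ks) (e : Js'' = Js.append Js') :
      CellPath Js'' f h (.cons K Ks)

namespace CellPath

variable {E : Type u} [CellData.{u, v, w, z} E]

/-- Concatenation of strings of 2-cells. -/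
def append : {X₀ X₁ X₂ Y₀ Y₁ Y₂ : E} → {Js : ProPath Pro X₀ X₁} → {Js' : ProPath Pro X₁ X₂} →
    {f : X₀ ⟶ Y₀} → {g : X₁ ⟶ Y₁} → {h : X₂ ⟶ Y₂} →
    {Ks : ProPath Pro Y₀ Y₁} → {Ks' : ProPath Pro Y₁ Y₂} →
    CellPath Js f g Ks → CellPath Js' g h Ks' → CellPath (Js.append Js') f h (Ks.append Ks')
  | _, _, _, _, _, _, _, _, _, _, _, _, _, nil _, βs => βs
  | _, _, _, _, _, _, _, _, _, _, _, _, _, cons α αs e, βs =>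
      cons α (append αs βs) (by rw [e, ProPath.append_assoc])

/-- Transport of a string of 2-cells along equalities of its domain and codomain. -/
def cast {X X' Y Y' : E} {Js Js' : ProPath Pro X X'} {f : X ⟶ Y} {g : X' ⟶ Y'}
    {Ks Ks' : ProPath Pro Y Y'} (αs : CellPath Js f g Ks) (e : Js' = Js) (e' : Ks' = Ks) :
    CellPath Js' f g Ks' :=
  e ▸ e' ▸ αs

/-- The string consisting of one 2-cell. -/
abbrev one {X X' Y Y' : E} {Js : ProPath Pro X X'} {f : X ⟶ Y} {g : X' ⟶ Y'} {K : Pro Y Y'}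
    (α : Cell Js f g K) : CellPath Js f g (.one K) :=
  cons α (nil g) Js.append_nil.symm

/-- The string consisting of two 2-cells. -/
abbrev two {X₀ X₁ X₂ Y₀ Y₁ Y₂ : E} {Js : ProPath Pro X₀ X₁} {Js' : ProPath Pro X₁ X₂}
    {f : X₀ ⟶ Y₀} {g : X₁ ⟶ Y₁} {h : X₂ ⟶ Y₂} {K : Pro Y₀ Y₁} {K' : Pro Y₁ Y₂}
    (α : Cell Js f g K) (β : Cell Js' g h K') :
    CellPath (Js.append Js') f h (.two K K') :=
  cons α (one β) rfl

/-- The string consisting of three 2-cells. -/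
abbrev three {X₀ X₁ X₂ X₃ Y₀ Y₁ Y₂ Y₃ : E} {Js : ProPath Pro X₀ X₁} {Js' : ProPath Pro X₁ X₂}
    {Js'' : ProPath Pro X₂ X₃}
    {f : X₀ ⟶ Y₀} {g : X₁ ⟶ Y₁} {h : X₂ ⟶ Y₂} {k : X₃ ⟶ Y₃}
    {K : Pro Y₀ Y₁} {K' : Pro Y₁ Y₂} {K'' : Pro Y₂ Y₃}
    (α : Cell Js f g K) (β : Cell Js' g h K') (γ : Cell Js'' h k K'') :
    CellPath (Js.append (Js'.append Js'')) f k (.three K K' K'') :=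
  cons α (two β γ) rfl

theorem cast_append_nil {X X' Y Y' : E} {Js : ProPath Pro X X'} {f : X ⟶ Y} {g : X' ⟶ Y'}
    {Ks : ProPath Pro Y Y'} (αs : CellPath Js f g Ks) :
    (αs.append (nil g)).cast Js.append_nil.symm Ks.append_nil.symm = αs := by
  have key : ∀ {X X' Y Y' : E} {Js : ProPath Pro X X'} {f : X ⟶ Y} {g : X' ⟶ Y'}
      {Ks : ProPath Pro Y Y'} (αs : CellPath Js f g Ks), HEq (αs.append (nil g)) αs := by
    intro X X' Y Y' Js f g Ks αs
    induction αs with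
    | nil => rfl
    | @cons X₀ X₁ X₂ Y₀ Y₁ Y₂ Js Js' Js'' f g h K Ks α αs e ih =>
      subst e
      have key2 : ∀ {L : ProPath Pro X₁ X₂} {M : ProPath Pro Y₁ Y₂} (hL : L = Js') (hM : M = Ks)
          (βs : CellPath L g h M) (_ : HEq βs αs) {N : ProPath Pro X₀ X₂}
          (e : N = Js.append L), HEq (cons α βs e) (cons α αs rfl) := by
        intro L M hL hM βs hβ N e
        subst hL; subst hM; cases hβ; subst e; rfl
      exact key2 (ProPath.append_nil _) (ProPath.append_nil _) _ ih _
  have key3 : ∀ {Js' : ProPath Pro X X'} {Ks' : ProPath Pro Y Y'} (βs : CellPath Js' f g Ks')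
      (e : Js = Js') (e' : Ks = Ks') (_ : HEq βs αs), βs.cast e e' = αs := by
    intro Js' Ks' βs e e' h
    subst e; subst e'; cases h; rfl
  exact key3 _ _ _ (key αs)

end CellPath

/-- The data of a virtual double category: identity 2-cells, and the composite `β(α₁, …, α_k)` of
a 2-cell with a string of 2-cells. The vertical sides of the composite are the composites of the
vertical sides; this is expressed by the equations `p` and `q`. -/
class CompData (E : Type u) extends CellData.{u, v, w, z} E where
  cid {X Y : E} (J : Pro X Y) : Cell (.one J) (𝟙 X) (𝟙 Y) J
  ccomp {X X' Y Y' Z Z' : E} {Js : ProPath Pro X X'} {f : X ⟶ Y} {f' : X' ⟶ Y'}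
    {Ks : ProPath Pro Y Y'} {g : Y ⟶ Z} {g' : Y' ⟶ Z'} {H : Pro Z Z'} {h : X ⟶ Z} {h' : X' ⟶ Z'}
    (αs : CellPath Js f f' Ks) (β : Cell Ks g g' H) (p : f ≫ g = h) (q : f' ≫ g' = h') :
    Cell Js h h' H

open CompData (cid ccomp)

/-- The string of identity 2-cells on a string of proarrows. -/
def idPath {E : Type u} [CompData.{u, v, w, z} E] : {X Y : E} → (Js : ProPath Pro X Y) →
    CellPath Js (𝟙 X) (𝟙 Y) Js
  | _, _, .nil X => .nil (𝟙 X)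
  | _, _, .cons J Js => .cons (cid J) (idPath Js) rfl

/-- Two-level arrangements of 2-cells: a string of 2-cells `α₁, …, α_k` together with, for every
`i`, a string of 2-cells `γ_{i1}, …, γ_{iq_i}` whose codomain is the domain of `α_i`. -/
inductive CellTower {E : Type u} [CompData.{u, v, w, z} E] :
    {X X' Y Y' Z Z' : E} → ProPath (Pro (E := E)) X X' → (X ⟶ Y) → (X' ⟶ Y') →
      ProPath (Pro (E := E)) Y Y' → (Y ⟶ Z) → (Y' ⟶ Z') → ProPath (Pro (E := E)) Z Z' →
      (X ⟶ Z) → (X' ⟶ Z') → Type (max u v w z)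
  | nil {X Y Z : E} {f : X ⟶ Y} {g : Y ⟶ Z} {h : X ⟶ Z} (p : f ≫ g = h) :
      CellTower (.nil X) f f (.nil Y) g g (.nil Z) h h
  | cons {X₀ X₁ X₂ Y₀ Y₁ Y₂ Z₀ Z₁ Z₂ : E} {Is : ProPath Pro X₀ X₁} {Is' : ProPath Pro X₁ X₂}
      {Is'' : ProPath Pro X₀ X₂} {Js : ProPath Pro Y₀ Y₁} {Js' : ProPath Pro Y₁ Y₂}
      {Js'' : ProPath Pro Y₀ Y₂} {K : Pro Z₀ Z₁} {Ks : ProPath Pro Z₁ Z₂}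
      {f₀ : X₀ ⟶ Y₀} {f₁ : X₁ ⟶ Y₁} {f₂ : X₂ ⟶ Y₂} {g₀ : Y₀ ⟶ Z₀} {g₁ : Y₁ ⟶ Z₁} {g₂ : Y₂ ⟶ Z₂}
      {h₀ : X₀ ⟶ Z₀} {h₁ : X₁ ⟶ Z₁} {h₂ : X₂ ⟶ Z₂}
      (γs : CellPath Is f₀ f₁ Js) (α : Cell Js g₀ g₁ K) (p : f₀ ≫ g₀ = h₀) (q : f₁ ≫ g₁ = h₁)
      (rest : CellTower Is' f₁ f₂ Js' g₁ g₂ Ks h₁ h₂)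
      (e : Is'' = Is.append Is') (e' : Js'' = Js.append Js') :
      CellTower Is'' f₀ f₂ Js'' g₀ g₂ (.cons K Ks) h₀ h₂

namespace CellTower

variable {E : Type u} [CompData.{u, v, w, z} E]

/-- The upper level `γ₁₁, …, γ_{kq_k}`. -/
def upper : {X X' Y Y' Z Z' : E} → {Is : ProPath (Pro (E := E)) X X'} → {f : X ⟶ Y} →
    {f' : X' ⟶ Y'} → {Js : ProPath (Pro (E := E)) Y Y'} → {g : Y ⟶ Z} → {g' : Y' ⟶ Z'} →
    {Ks : ProPath (Pro (E := E)) Z Z'} → {h : X ⟶ Z} → {h' : X' ⟶ Z'} →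
    CellTower Is f f' Js g g' Ks h h' → CellPath Is f f' Js
  | _, _, _, _, _, _, _, _, _, _, _, _, _, _, _, nil (f := f) _ => .nil f
  | _, _, _, _, _, _, _, _, _, _, _, _, _, _, _, cons γs _ _ _ rest e e' =>
      (γs.append (upper rest)).cast e e'

/-- The lower level `α₁, …, α_k`. -/
def lower : {X X' Y Y' Z Z' : E} → {Is : ProPath (Pro (E := E)) X X'} → {f : X ⟶ Y} →
    {f' : X' ⟶ Y'} → {Js : ProPath (Pro (E := E)) Y Y'} → {g : Y ⟶ Z} → {g' : Y' ⟶ Z'} →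
    {Ks : ProPath (Pro (E := E)) Z Z'} → {h : X ⟶ Z} → {h' : X' ⟶ Z'} →
    CellTower Is f f' Js g g' Ks h h' → CellPath Js g g' Ks
  | _, _, _, _, _, _, _, _, _, _, _, _, _, _, _, nil (g := g) _ => .nil g
  | _, _, _, _, _, _, _, _, _, _, _, _, _, _, _, cons _ α _ _ rest _ e' =>
      .cons α (lower rest) e'

/-- The string of the composites `α₁(γ₁₁, …, γ_{1q₁}), …, α_k(γ_{k1}, …, γ_{kq_k})`. -/
def composite : {X X' Y Y' Z Z' : E} → {Is : ProPath (Pro (E := E)) X X'} → {f : X ⟶ Y} →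
    {f' : X' ⟶ Y'} → {Js : ProPath (Pro (E := E)) Y Y'} → {g : Y ⟶ Z} → {g' : Y' ⟶ Z'} →
    {Ks : ProPath (Pro (E := E)) Z Z'} → {h : X ⟶ Z} → {h' : X' ⟶ Z'} →
    CellTower Is f f' Js g g' Ks h h' → CellPath Is h h' Ks
  | _, _, _, _, _, _, _, _, _, _, _, _, _, _, _, nil (h := h) _ => .nil h
  | _, _, _, _, _, _, _, _, _, _, _, _, _, _, _, cons γs α p q rest e _ =>
      .cons (ccomp γs α p q) (composite rest) e

end CellTower

/-- Virtual double categories. -/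
class VirtualDoubleCategory (E : Type u) extends CompData.{u, v, w, z} E where
  /-- `β(id, …, id) = β` -/
  idPath_ccomp {X X' Y Y' : E} {Js : ProPath Pro X X'} {f : X ⟶ Y} {g : X' ⟶ Y'} {K : Pro Y Y'}
    (β : Cell Js f g K) : ccomp (idPath Js) β (Category.id_comp f) (Category.id_comp g) = β
  /-- `id(α) = α` -/
  ccomp_cid {X X' Y Y' : E} {Js : ProPath Pro X X'} {f : X ⟶ Y} {g : X' ⟶ Y'} {K : Pro Y Y'}
    (α : Cell Js f g K) :
    ccomp (CellPath.one α) (cid K) (Category.comp_id f) (Category.comp_id g) = α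
  /-- `β(α₁(γ₁₁, …), …, α_k(γ_{k1}, …)) = (β(α₁, …, α_k))(γ₁₁, …, γ_{kq_k})` -/
  ccomp_assoc {X X' Y Y' Z Z' W W' : E} {Is : ProPath Pro X X'} {f : X ⟶ Y} {f' : X' ⟶ Y'}
    {Js : ProPath Pro Y Y'} {g : Y ⟶ Z} {g' : Y' ⟶ Z'} {Ks : ProPath Pro Z Z'}
    {h : X ⟶ Z} {h' : X' ⟶ Z'} {k : Z ⟶ W} {k' : Z' ⟶ W'} {H : Pro W W'}
    {m : X ⟶ W} {m' : X' ⟶ W'} {n : Y ⟶ W} {n' : Y' ⟶ W'}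
    (T : CellTower Is f f' Js g g' Ks h h') (β : Cell Ks k k' H)
    (p : h ≫ k = m) (p' : h' ≫ k' = m') (q : g ≫ k = n) (q' : g' ≫ k' = n')
    (r : f ≫ n = m) (r' : f' ≫ n' = m') :
    ccomp T.composite β p p' = ccomp T.upper (ccomp T.lower β q q') r r'

/-! ## Composites, units, restrictions; virtual equipments -/

section Universal

variable {E : Type u} [VirtualDoubleCategory.{u, v, w, z} E]

/-- A 2-cell `J₁, …, J_k → J` with identity vertical sides exhibits `J` as the composite of
`J₁, …, J_k`: every 2-cell with domain `K₁, …, K_m, J₁, …, J_k, Q₁, …, Q_n` factors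
uniquely through it. -/
def IsComposite {X X' : E} {Js : ProPath Pro X X'} {J : Pro X X'}
    (c : Cell Js (𝟙 X) (𝟙 X') J) : Prop :=
  ∀ ⦃Z W Y Y' : E⦄ (Ks : ProPath Pro Z X) (Qs : ProPath Pro X' W) (f : Z ⟶ Y) (g : W ⟶ Y')
    (K : Pro Y Y') (α : Cell (Ks.append (Js.append Qs)) f g K),
    ∃! β : Cell (Ks.append (.cons J Qs)) f g K,
      ccomp ((idPath Ks).append (.cons c (idPath Qs) rfl)) β
        (Category.id_comp f) (Category.id_comp g) = α

/-- A unit for `A` is a composite of the empty string at `A`. -/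
abbrev IsUnitCell {A : E} {U : Pro A A} (c : Cell (.nil A) (𝟙 A) (𝟙 A) U) : Prop :=
  IsComposite c

/-- Cartesian 2-cells. -/
def IsCartesian {X X' Y Y' : E} {R : Pro X X'} {f : X ⟶ Y} {g : X' ⟶ Y'} {K : Pro Y Y'}
    (c : Cell (.one R) f g K) : Prop :=
  ∀ ⦃Z Z' : E⦄ (Js : ProPath Pro Z Z') (h : Z ⟶ X) (k : Z' ⟶ X')
    (α : Cell Js (h ≫ f) (k ≫ g) K),
    ∃! β : Cell Js h k R, ccomp (CellPath.one β) c rfl rfl = α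

end Universal

/-- Virtual equipments: virtual double categories in which every object `A` has a unit `unit A`
and every proarrow `K` has a restriction `restr K f g = K(f, g)` along all compatible vertical
arrows `f`, `g`. (Units and restrictions are unique up to isomorphism; the structure records a
choice, which is arbitrary.) -/
class VirtualEquipment (E : Type u) extends VirtualDoubleCategory.{u, v, w, z} E where
  unit (A : E) : Pro A A
  unitCell (A : E) : Cell (.nil A) (𝟙 A) (𝟙 A) (unit A)
  unitCell_isUnit (A : E) : IsUnitCell (E := E) (unitCell A)
  restr {X X' Y Y' : E} (K : Pro Y Y') (f : X ⟶ Y) (g : X' ⟶ Y') : Pro X X'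
  cart {X X' Y Y' : E} (K : Pro Y Y') (f : X ⟶ Y) (g : X' ⟶ Y') : Cell (.one (restr K f g)) f g K
  cart_isCartesian {X X' Y Y' : E} (K : Pro Y Y') (f : X ⟶ Y) (g : X' ⟶ Y') :
    IsCartesian (E := E) (cart K f g)

open VirtualDoubleCategory (idPath_ccomp ccomp_cid ccomp_assoc)
open VirtualEquipment (unit unitCell unitCell_isUnit restr cart cart_isCartesian)

/-- The identity `𝟙 ≫ 𝟙 = 𝟙`, for the vertical sides of composites of globular 2-cells. -/
theorem ii {E : Type u} [Category.{v} E] (X : E) : 𝟙 X ≫ 𝟙 X = 𝟙 X := Category.comp_id _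

/-! ### Special cases of associativity -/

section Calculus

variable {E : Type u} [VirtualDoubleCategory.{u, v, w, z} E]

theorem ccomp_one {X X' Y Y' Z Z' W W' : E} {Is : ProPath Pro X X'} {f : X ⟶ Y} {f' : X' ⟶ Y'}
    {Js : ProPath Pro Y Y'} {g : Y ⟶ Z} {g' : Y' ⟶ Z'} {K : Pro Z Z'} {h : X ⟶ Z} {h' : X' ⟶ Z'}
    {k : Z ⟶ W} {k' : Z' ⟶ W'} {H : Pro W W'} {m : X ⟶ W} {m' : X' ⟶ W'}
    {n : Y ⟶ W} {n' : Y' ⟶ W'}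
    (γs : CellPath Is f f' Js) (α : Cell Js g g' K) (β : Cell (.one K) k k' H)
    (p : f ≫ g = h) (p' : f' ≫ g' = h') (q : h ≫ k = m) (q' : h' ≫ k' = m')
    (r : g ≫ k = n) (r' : g' ≫ k' = n') (s : f ≫ n = m) (s' : f' ≫ n' = m') :
    ccomp (.one (ccomp γs α p p')) β q q' = ccomp γs (ccomp (.one α) β r r') s s' := by
  have := ccomp_assoc (.cons γs α p p' (.nil p') Is.append_nil.symm Js.append_nil.symm)
    β q q' r r' s s'
  simp only [CellTower.upper, CellTower.lower, CellTower.composite,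
    CellPath.cast_append_nil] at this
  exact this

theorem ccomp_two {X₀ X₁ X₂ Y₀ Y₁ Y₂ Z₀ Z₁ Z₂ W W' : E}
    {Is : ProPath Pro X₀ X₁} {Is' : ProPath Pro X₁ X₂}
    {f₀ : X₀ ⟶ Y₀} {f₁ : X₁ ⟶ Y₁} {f₂ : X₂ ⟶ Y₂} {Js : ProPath Pro Y₀ Y₁} {Js' : ProPath Pro Y₁ Y₂}
    {g₀ : Y₀ ⟶ Z₀} {g₁ : Y₁ ⟶ Z₁} {g₂ : Y₂ ⟶ Z₂} {K : Pro Z₀ Z₁} {K' : Pro Z₁ Z₂}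
    {h₀ : X₀ ⟶ Z₀} {h₁ : X₁ ⟶ Z₁} {h₂ : X₂ ⟶ Z₂}
    {k : Z₀ ⟶ W} {k' : Z₂ ⟶ W'} {H : Pro W W'} {m : X₀ ⟶ W} {m' : X₂ ⟶ W'}
    {n : Y₀ ⟶ W} {n' : Y₂ ⟶ W'}
    (γs : CellPath Is f₀ f₁ Js) (α : Cell Js g₀ g₁ K)
    (γs' : CellPath Is' f₁ f₂ Js') (α' : Cell Js' g₁ g₂ K')
    (β : Cell (.two K K') k k' H)
    (p₀ : f₀ ≫ g₀ = h₀) (p₁ : f₁ ≫ g₁ = h₁) (p₂ : f₂ ≫ g₂ = h₂)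
    (q : h₀ ≫ k = m) (q' : h₂ ≫ k' = m')
    (r : g₀ ≫ k = n) (r' : g₂ ≫ k' = n') (s : f₀ ≫ n = m) (s' : f₂ ≫ n' = m') :
    ccomp (.two (ccomp γs α p₀ p₁) (ccomp γs' α' p₁ p₂)) β q q' =
      ccomp (γs.append γs') (ccomp (.two α α') β r r') s s' := by
  have := ccomp_assoc (.cons γs α p₀ p₁ (.cons γs' α' p₁ p₂ (.nil p₂) Is'.append_nil.symm
    Js'.append_nil.symm) rfl rfl) β q q' r r' s s'
  simp only [CellTower.upper, CellTower.lower, CellTower.composite,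
    CellPath.cast_append_nil] at this
  exact this

theorem two_two {X₀ X₁ X₂ Y₀ Y₁ Y₂ Z₀ Z₁ Z₂ W W' : E}
    {Is : ProPath Pro X₀ X₁} {Is' : ProPath Pro X₁ X₂}
    {f₀ : X₀ ⟶ Y₀} {f₁ : X₁ ⟶ Y₁} {f₂ : X₂ ⟶ Y₂} {J : Pro Y₀ Y₁} {J' : Pro Y₁ Y₂}
    {g₀ : Y₀ ⟶ Z₀} {g₁ : Y₁ ⟶ Z₁} {g₂ : Y₂ ⟶ Z₂} {K : Pro Z₀ Z₁} {K' : Pro Z₁ Z₂}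
    {h₀ : X₀ ⟶ Z₀} {h₁ : X₁ ⟶ Z₁} {h₂ : X₂ ⟶ Z₂}
    {k : Z₀ ⟶ W} {k' : Z₂ ⟶ W'} {H : Pro W W'} {m : X₀ ⟶ W} {m' : X₂ ⟶ W'}
    {n : Y₀ ⟶ W} {n' : Y₂ ⟶ W'}
    (γ : Cell Is f₀ f₁ J) (α : Cell (.one J) g₀ g₁ K)
    (γ' : Cell Is' f₁ f₂ J') (α' : Cell (.one J') g₁ g₂ K')
    (β : Cell (.two K K') k k' H)
    (r : g₀ ≫ k = n) (r' : g₂ ≫ k' = n') (s : f₀ ≫ n = m) (s' : f₂ ≫ n' = m')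
    (p₀ : f₀ ≫ g₀ = h₀) (p₁ : f₁ ≫ g₁ = h₁) (p₂ : f₂ ≫ g₂ = h₂)
    (q : h₀ ≫ k = m) (q' : h₂ ≫ k' = m') :
    ccomp (.two γ γ') (ccomp (.two α α') β r r') s s' =
      ccomp (.two (ccomp (.one γ) α p₀ p₁) (ccomp (.one γ') α' p₁ p₂)) β q q' :=
  (ccomp_two (.one γ) α (.one γ') α' β p₀ p₁ p₂ q q' r r' s s').symm

theorem ccomp_three {X₀ X₁ X₂ X₃ Y₀ Y₁ Y₂ Y₃ Z₀ Z₁ Z₂ Z₃ W W' : E}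
    {Is : ProPath Pro X₀ X₁} {Is' : ProPath Pro X₁ X₂} {Is'' : ProPath Pro X₂ X₃}
    {f₀ : X₀ ⟶ Y₀} {f₁ : X₁ ⟶ Y₁} {f₂ : X₂ ⟶ Y₂} {f₃ : X₃ ⟶ Y₃}
    {Js : ProPath Pro Y₀ Y₁} {Js' : ProPath Pro Y₁ Y₂} {Js'' : ProPath Pro Y₂ Y₃}
    {g₀ : Y₀ ⟶ Z₀} {g₁ : Y₁ ⟶ Z₁} {g₂ : Y₂ ⟶ Z₂} {g₃ : Y₃ ⟶ Z₃}
    {K : Pro Z₀ Z₁} {K' : Pro Z₁ Z₂} {K'' : Pro Z₂ Z₃}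
    {h₀ : X₀ ⟶ Z₀} {h₁ : X₁ ⟶ Z₁} {h₂ : X₂ ⟶ Z₂} {h₃ : X₃ ⟶ Z₃}
    {k : Z₀ ⟶ W} {k' : Z₃ ⟶ W'} {H : Pro W W'} {m : X₀ ⟶ W} {m' : X₃ ⟶ W'}
    {n : Y₀ ⟶ W} {n' : Y₃ ⟶ W'}
    (γs : CellPath Is f₀ f₁ Js) (α : Cell Js g₀ g₁ K)
    (γs' : CellPath Is' f₁ f₂ Js') (α' : Cell Js' g₁ g₂ K')
    (γs'' : CellPath Is'' f₂ f₃ Js'') (α'' : Cell Js'' g₂ g₃ K'')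
    (β : Cell (.three K K' K'') k k' H)
    (p₀ : f₀ ≫ g₀ = h₀) (p₁ : f₁ ≫ g₁ = h₁) (p₂ : f₂ ≫ g₂ = h₂) (p₃ : f₃ ≫ g₃ = h₃)
    (q : h₀ ≫ k = m) (q' : h₃ ≫ k' = m')
    (r : g₀ ≫ k = n) (r' : g₃ ≫ k' = n') (s : f₀ ≫ n = m) (s' : f₃ ≫ n' = m') :
    ccomp (.three (ccomp γs α p₀ p₁) (ccomp γs' α' p₁ p₂) (ccomp γs'' α'' p₂ p₃)) β q q' =
      ccomp (γs.append (γs'.append γs'')) (ccomp (.three α α' α'') β r r') s s' := by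
  have := ccomp_assoc (.cons γs α p₀ p₁ (.cons γs' α' p₁ p₂ (.cons γs'' α'' p₂ p₃ (.nil p₃)
    Is''.append_nil.symm Js''.append_nil.symm) rfl rfl) rfl rfl) β q q' r r' s s'
  simp only [CellTower.upper, CellTower.lower, CellTower.composite,
    CellPath.cast_append_nil] at this
  exact this

theorem nil_ccomp {X Y Y' : E} {f : X ⟶ Y} {g : X ⟶ Y'} {K : Pro Y Y'}
    (β : Cell (.nil X) f g K) (p : 𝟙 X ≫ f = f) (q : 𝟙 X ≫ g = g) :
    ccomp (.nil (𝟙 X)) β p q = β :=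
  idPath_ccomp β

theorem cid_ccomp {X X' Y Y' : E} {J : Pro X X'} {f : X ⟶ Y} {g : X' ⟶ Y'} {K : Pro Y Y'}
    (β : Cell (.one J) f g K) (p : 𝟙 X ≫ f = f) (q : 𝟙 X' ≫ g = g) :
    ccomp (.one (cid J)) β p q = β :=
  idPath_ccomp β

theorem CellPath.cast_cons {X₀ X₁ X₂ Y₀ Y₁ Y₂ : E} {Js : ProPath Pro X₀ X₁} {Js' : ProPath Pro X₁ X₂}
    {Js'' Js₁ : ProPath Pro X₀ X₂} {f : X₀ ⟶ Y₀} {g : X₁ ⟶ Y₁} {h : X₂ ⟶ Y₂}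
    {K : Pro Y₀ Y₁} {Ks : ProPath Pro Y₁ Y₂}
    (α : Cell Js f g K) (αs : CellPath Js' g h Ks) (e : Js'' = Js.append Js') (e' : Js₁ = Js'') :
    (CellPath.cons α αs e).cast e' rfl = CellPath.cons α αs (e'.trans e) := by
  subst e'; rfl

/-- The composite of a globular binary 2-cell with two 2-cells. -/
abbrev op {X₀ X₁ X₂ Y₀ Y₁ Y₂ : E} {Is : ProPath Pro X₀ X₁} {Is' : ProPath Pro X₁ X₂}
    {h₀ : X₀ ⟶ Y₀} {h₁ : X₁ ⟶ Y₁} {h₂ : X₂ ⟶ Y₂} {J : Pro Y₀ Y₁} {J' : Pro Y₁ Y₂} {K : Pro Y₀ Y₂}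
    (z : Cell (.two J J') (𝟙 Y₀) (𝟙 Y₂) K) (a : Cell Is h₀ h₁ J) (b : Cell Is' h₁ h₂ J') :
    Cell (Is.append Is') h₀ h₂ K :=
  ccomp (.two a b) z (Category.comp_id _) (Category.comp_id _)

section Three

variable {X₀ X₁ X₂ X₃ Y₀ Y₁ Y₂ Y₃ : E}
    {Is : ProPath Pro X₀ X₁} {Is' : ProPath Pro X₁ X₂} {Is'' : ProPath Pro X₂ X₃}
    {h₀ : X₀ ⟶ Y₀} {h₁ : X₁ ⟶ Y₁} {h₂ : X₂ ⟶ Y₂} {h₃ : X₃ ⟶ Y₃}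
    {J : Pro Y₀ Y₁} {J' : Pro Y₁ Y₂} {J'' : Pro Y₂ Y₃}

theorem three_left {K : Pro Y₀ Y₂} {H : Pro Y₀ Y₃}
    (a : Cell Is h₀ h₁ J) (b : Cell Is' h₁ h₂ J') (c : Cell Is'' h₂ h₃ J'')
    (x : Cell (.two J J') (𝟙 _) (𝟙 _) K) (y : Cell (.two K J'') (𝟙 _) (𝟙 _) H) :
    ccomp (.three a b c) (op y x (cid J'')) (Category.comp_id _) (Category.comp_id _) =
      ccomp (.cons (op x a b) (.one c) (ProPath.append_assoc _ _ _).symm) y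
        (Category.comp_id _) (Category.comp_id _) := by
  have := ccomp_assoc (.cons (.two a b) x (Category.comp_id _) (Category.comp_id _)
    (.cons (.one c) (cid J'') (Category.comp_id _) (Category.comp_id _)
      (.nil (Category.comp_id _)) (ProPath.append_nil _).symm rfl)
      (ProPath.append_assoc _ _ _).symm rfl) y (Category.comp_id _) (Category.comp_id _)
      (Category.comp_id _) (Category.comp_id _) (Category.comp_id _) (Category.comp_id _)
  simp only [CellTower.upper, CellTower.lower, CellTower.composite, ccomp_cid,
    CellPath.append, CellPath.cast_cons] at this
  exact this.symm

theorem three_right {K : Pro Y₁ Y₃} {H : Pro Y₀ Y₃}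
    (a : Cell Is h₀ h₁ J) (b : Cell Is' h₁ h₂ J') (c : Cell Is'' h₂ h₃ J'')
    (x : Cell (.two J' J'') (𝟙 _) (𝟙 _) K) (y : Cell (.two J K) (𝟙 _) (𝟙 _) H) :
    ccomp (.three a b c) (op y (cid J) x) (Category.comp_id _) (Category.comp_id _) =
      op y a (op x b c) := by
  refine (ccomp_two (.one a) (cid J) (.two b c) x y (Category.comp_id _) (Category.comp_id _)
    (Category.comp_id _) (Category.comp_id _) (Category.comp_id _) _ _ _ _).symm.trans ?_
  rw [ccomp_cid]

end Three

end Calculus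

/-! ### The canonical operations in a virtual equipment -/

section Equipment

variable {E : Type u} [VirtualEquipment.{u, v, w, z} E]

/-- The factorization of a 2-cell through the cartesian 2-cell of a restriction. -/
noncomputable def lift {X X' Y Y' Z Z' : E} {K : Pro Y Y'} {f : X ⟶ Y} {g : X' ⟶ Y'}
    {Js : ProPath Pro Z Z'} {F : Z ⟶ Y} {G : Z' ⟶ Y'} (h : Z ⟶ X) (k : Z' ⟶ X')
    (α : Cell Js F G K) (p : h ≫ f = F) (q : k ≫ g = G) : Cell Js h k (restr K f g) :=
  (cart_isCartesian K f g Js h k (p ▸ q ▸ α)).choose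

theorem lift_cart {X X' Y Y' Z Z' : E} {K : Pro Y Y'} {f : X ⟶ Y} {g : X' ⟶ Y'}
    {Js : ProPath Pro Z Z'} {F : Z ⟶ Y} {G : Z' ⟶ Y'} (h : Z ⟶ X) (k : Z' ⟶ X')
    (α : Cell Js F G K) (p : h ≫ f = F) (q : k ≫ g = G) :
    ccomp (.one (lift h k α p q)) (cart K f g) p q = α := by
  subst p; subst q
  exact (cart_isCartesian K f g Js h k α).choose_spec.1

theorem cart_ext {X X' Y Y' Z Z' : E} {K : Pro Y Y'} {f : X ⟶ Y} {g : X' ⟶ Y'}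
    {Js : ProPath Pro Z Z'} {h : Z ⟶ X} {k : Z' ⟶ X'} {F : Z ⟶ Y} {G : Z' ⟶ Y'}
    (β β' : Cell Js h k (restr K f g)) (p : h ≫ f = F) (q : k ≫ g = G)
    (e : ccomp (.one β) (cart K f g) p q = ccomp (.one β') (cart K f g) p q) : β = β' := by
  subst p; subst q
  exact (cart_isCartesian K f g Js h k _).unique e rfl

theorem exists_lunit {X Y : E} (K : Pro X Y) :
    ∃! l : Cell (.two (unit X) K) (𝟙 X) (𝟙 Y) K,
      ccomp (.two (unitCell X) (cid K)) l (Category.comp_id _) (Category.comp_id _) = cid K :=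
  unitCell_isUnit X (.nil X) (.one K) _ _ _ (cid K)

theorem exists_runit {X Y : E} (K : Pro X Y) :
    ∃! l : Cell (.two K (unit Y)) (𝟙 X) (𝟙 Y) K,
      ccomp (.two (cid K) (unitCell Y)) l (Category.comp_id _) (Category.comp_id _) = cid K :=
  unitCell_isUnit Y (.one K) (.nil Y) _ _ _ (cid K)

/-- The canonical 2-cell `unit X, K → K`. -/
noncomputable def lunit {X Y : E} (K : Pro X Y) : Cell (.two (unit X) K) (𝟙 X) (𝟙 Y) K :=
  (exists_lunit K).choose

/-- The canonical 2-cell `K, unit Y → K`. -/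
noncomputable def runit {X Y : E} (K : Pro X Y) : Cell (.two K (unit Y)) (𝟙 X) (𝟙 Y) K :=
  (exists_runit K).choose

theorem unit_lunit {X Y : E} (K : Pro X Y) :
    op (lunit K) (unitCell X) (cid K) = cid K :=
  (exists_lunit K).choose_spec.1

theorem unit_runit {X Y : E} (K : Pro X Y) :
    op (runit K) (cid K) (unitCell Y) = cid K :=
  (exists_runit K).choose_spec.1

theorem op_lunit {X X' Y Y' : E} {Js : ProPath Pro X X'} {f : X ⟶ Y} {g : X' ⟶ Y'} {K : Pro Y Y'}
    (p : f ≫ 𝟙 Y = f) (α : Cell Js f g K) :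
    op (lunit K) (ccomp (.nil f) (unitCell Y) p p) α = α := by
  have := ccomp_two (.nil f) (unitCell Y) (.one α) (cid K) (lunit K) p p (Category.comp_id _) p
    (Category.comp_id _) (ii _) (ii _) p (Category.comp_id _)
  rw [ccomp_cid, show ccomp (.two (unitCell Y) (cid K)) _ _ _ = _ from unit_lunit K] at this
  exact this.trans (ccomp_cid _)

theorem op_lunit' {X Y : E} {Js : ProPath Pro X Y} {K : Pro X Y} (α : Cell Js (𝟙 X) (𝟙 Y) K) :
    op (lunit K) (unitCell X) α = α := by
  have := op_lunit (ii _) α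
  rwa [nil_ccomp] at this

theorem op_runit {X X' Y Y' : E} {J : Pro X X'} {f : X ⟶ Y} {g : X' ⟶ Y'} {K : Pro Y Y'}
    (p : g ≫ 𝟙 Y' = g) (α : Cell (.one J) f g K) :
    op (runit K) α (ccomp (.nil g) (unitCell Y') p p) = α := by
  have := ccomp_two (.one α) (cid K) (.nil g) (unitCell Y') (runit K) (Category.comp_id _) p p
    (Category.comp_id _) p (ii _) (ii _) (Category.comp_id _) p
  rw [ccomp_cid, show ccomp (.two (cid K) (unitCell _)) _ _ _ = _ from unit_runit K] at this
  exact this.trans (ccomp_cid _)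

theorem op_runit_three {X Y Z : E} {J : Pro X Y} {J' : Pro Y Z} {K : Pro X Z}
    (α : Cell (.two J J') (𝟙 X) (𝟙 Z) K) :
    op (runit K) α (unitCell Z) = α := by
  have := ccomp_two (.one α) (cid K) (.nil (𝟙 Z)) (unitCell Z) (runit K) (Category.comp_id _)
    (ii _) (ii _) (ii _) (ii _) (ii _) (ii _) (ii _) (ii _)
  rw [ccomp_cid, show ccomp (.two (cid K) (unitCell _)) _ _ _ = _ from unit_runit K, nil_ccomp] at this
  exact this.trans (ccomp_cid _)

theorem op_runit' {X Y : E} {J K : Pro X Y} (α : Cell (.one J) (𝟙 X) (𝟙 Y) K) :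
    op (runit K) α (unitCell Y) = α := by
  have := op_runit (ii _) α
  rwa [nil_ccomp] at this

theorem unit_extL {X W Y Y' : E} {Qs : ProPath Pro X W} {f : X ⟶ Y} {g : W ⟶ Y'} {K : Pro Y Y'}
    (β β' : Cell (.cons (unit X) Qs) f g K)
    (e : ccomp (.cons (unitCell X) (idPath Qs) rfl) β (Category.id_comp f) (Category.id_comp g) =
      ccomp (.cons (unitCell X) (idPath Qs) rfl) β' (Category.id_comp f) (Category.id_comp g)) :
    β = β' :=
  (unitCell_isUnit X (.nil X) Qs f g K _).unique e rfl

theorem unit_extR {X W Y Y' : E} {Ks : ProPath Pro W X} {f : W ⟶ Y} {g : X ⟶ Y'} {K : Pro Y Y'}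
    (β β' : Cell (Ks.append (.one (unit X))) f g K)
    (e : ccomp ((idPath Ks).append (.cons (unitCell X) (.nil _) rfl)) β
        (Category.id_comp f) (Category.id_comp g) =
      ccomp ((idPath Ks).append (.cons (unitCell X) (.nil _) rfl)) β'
        (Category.id_comp f) (Category.id_comp g)) :
    β = β' :=
  (unitCell_isUnit X Ks (.nil X) f g K _).unique e rfl

theorem two_cid {X Y Z : E} {J : Pro X Y} {J' : Pro Y Z} {K : Pro X Z}
    (β : Cell (.two J J') (𝟙 X) (𝟙 Z) K) : op β (cid J) (cid J') = β :=
  idPath_ccomp β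

theorem runit_unit (A : E) : runit (unit A) = lunit (unit A) := by
  have h : op (runit (unit A)) (unitCell A) (cid (unit A)) = cid (unit A) := by
    apply unit_extL (Qs := .nil A)
    have h1 := ccomp_two (.nil (𝟙 A)) (unitCell A) (.one (unitCell A)) (cid (unit A))
      (runit (unit A)) (ii _) (ii _) (ii _) (ii _) (ii _) (ii _) (ii _) (ii _) (ii _)
    have h2 := ccomp_two (.one (unitCell A)) (cid (unit A)) (.nil (𝟙 A)) (unitCell A)
      (runit (unit A)) (ii _) (ii _) (ii _) (ii _) (ii _) (ii _) (ii _) (ii _) (ii _)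
    rw [show ccomp (.two (cid (unit A)) (unitCell A)) _ _ _ = _ from unit_runit _] at h2
    exact h1.symm.trans ((by rw [nil_ccomp, ccomp_cid] : _ = _).trans
      ((by rw [nil_ccomp, ccomp_cid] : _ = _).trans h2))
  apply unit_extL (Qs := .one (unit A))
  exact h.trans (unit_lunit _).symm

theorem lunit_assoc {X Y : E} (K : Pro X Y) :
    op (lunit K) (lunit (unit X)) (cid K) = op (lunit K) (cid (unit X)) (lunit K) := by
  apply unit_extL (Qs := .two (unit X) K)
  refine (three_left (unitCell X) (cid (unit X)) (cid K) _ _).trans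
    (Eq.trans ?_ (three_right (unitCell X) (cid (unit X)) (cid K) _ _).symm)
  rw [unit_lunit, two_cid, op_lunit']
  exact two_cid _

theorem lunit_runit {X Y : E} (K : Pro X Y) :
    op (runit K) (lunit K) (cid (unit Y)) = op (lunit K) (cid (unit X)) (runit K) := by
  apply unit_extL (Qs := .two K (unit Y))
  refine (three_left (unitCell X) (cid K) (cid (unit Y)) _ _).trans
    (Eq.trans ?_ (three_right (unitCell X) (cid K) (cid (unit Y)) _ _).symm)
  rw [unit_lunit, two_cid, op_lunit']
  exact two_cid _

theorem runit_assoc {X Y : E} (K : Pro X Y) :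
    op (runit K) (cid K) (lunit (unit Y)) = op (runit K) (runit K) (cid (unit Y)) := by
  apply unit_extR (Ks := .two K (unit Y))
  refine (three_right (cid K) (cid (unit Y)) (unitCell Y) _ _).trans
    (Eq.trans ?_ (three_left (cid K) (cid (unit Y)) (unitCell Y) _ _).symm)
  rw [← runit_unit, unit_runit, two_cid]
  exact (op_runit_three _).symm

theorem lunit_natural {X Y : E} {K K' : Pro X Y} (φ : Cell (.one K) (𝟙 X) (𝟙 Y) K') :
    ccomp (.one (lunit K)) φ (ii _) (ii _) = op (lunit K') (cid (unit X)) φ := by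
  apply unit_extL (Qs := .one K)
  refine (ccomp_one (.two (unitCell X) (cid K)) (lunit K) φ (ii _) (ii _) (ii _) (ii _)
    (ii _) (ii _) (ii _) (ii _)).symm.trans (Eq.trans ?_ (two_two (unitCell X) (cid (unit X))
      (cid K) φ (lunit K') (ii _) (ii _) (ii _) (ii _) (ii _) (ii _) (ii _) (ii _) (ii _)).symm)
  rw [show ccomp (.two (unitCell X) (cid K)) _ _ _ = _ from unit_lunit K, ccomp_cid, cid_ccomp]
  exact (op_lunit' φ).symm

theorem runit_natural {X Y : E} {K K' : Pro X Y} (φ : Cell (.one K) (𝟙 X) (𝟙 Y) K') :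
    ccomp (.one (runit K)) φ (ii _) (ii _) = op (runit K') φ (cid (unit Y)) := by
  apply unit_extR (Ks := .one K)
  refine (ccomp_one (.two (cid K) (unitCell Y)) (runit K) φ (ii _) (ii _) (ii _) (ii _)
    (ii _) (ii _) (ii _) (ii _)).symm.trans (Eq.trans ?_ (two_two (cid K) φ (unitCell Y)
      (cid (unit Y)) (runit K') (ii _) (ii _) (ii _) (ii _) (ii _) (ii _) (ii _) (ii _)
      (ii _)).symm)
  rw [show ccomp (.two (cid K) (unitCell Y)) _ _ _ = _ from unit_runit K, ccomp_cid, cid_ccomp]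
  exact (op_runit' φ).symm

/-- The restriction of a globular binary 2-cell along three vertical arrows. -/
noncomputable def restrOp {X₀ X₁ X₂ Y₀ Y₁ Y₂ : E} {J : Pro Y₀ Y₁} {J' : Pro Y₁ Y₂} {K : Pro Y₀ Y₂}
    (z : Cell (.two J J') (𝟙 Y₀) (𝟙 Y₂) K) (f : X₀ ⟶ Y₀) (g : X₁ ⟶ Y₁) (h : X₂ ⟶ Y₂) :
    Cell (.two (restr J f g) (restr J' g h)) (𝟙 X₀) (𝟙 X₂) (restr K f h) :=
  lift (𝟙 X₀) (𝟙 X₂) (op z (cart J f g) (cart J' g h)) (Category.id_comp _) (Category.id_comp _)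

theorem restrOp_cart {X₀ X₁ X₂ Y₀ Y₁ Y₂ Z₀ Z₁ Z₂ : E} {J : Pro Y₀ Y₁} {J' : Pro Y₁ Y₂}
    {K : Pro Y₀ Y₂} (z : Cell (.two J J') (𝟙 Y₀) (𝟙 Y₂) K)
    (f : X₀ ⟶ Y₀) (g : X₁ ⟶ Y₁) (h : X₂ ⟶ Y₂) {Is : ProPath Pro Z₀ Z₁} {Is' : ProPath Pro Z₁ Z₂}
    {k₀ : Z₀ ⟶ X₀} {k₁ : Z₁ ⟶ X₁} {k₂ : Z₂ ⟶ X₂} {l₀ : Z₀ ⟶ Y₀} {l₁ : Z₁ ⟶ Y₁} {l₂ : Z₂ ⟶ Y₂}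
    (a : Cell Is k₀ k₁ (restr J f g)) (b : Cell Is' k₁ k₂ (restr J' g h))
    (p₀ : k₀ ≫ f = l₀) (p₁ : k₁ ≫ g = l₁) (p₂ : k₂ ≫ h = l₂) :
    ccomp (.one (op (restrOp z f g h) a b)) (cart K f h) p₀ p₂ =
      op z (ccomp (.one a) (cart J f g) p₀ p₁) (ccomp (.one b) (cart J' g h) p₁ p₂) := by
  rw [op, ccomp_one _ _ _ _ _ _ _ (Category.id_comp _) (Category.id_comp _) p₀ p₂, restrOp,
    lift_cart]
  exact two_two _ _ _ _ _ _ _ _ _ _ _ _ _ _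

theorem restrOp_assoc {X₀ X₁ X₂ X₃ Y₀ Y₁ Y₂ Y₃ : E} {J : Pro Y₀ Y₁} {J' : Pro Y₁ Y₂}
    {J'' : Pro Y₂ Y₃} {K : Pro Y₀ Y₂} {L : Pro Y₁ Y₃} {H : Pro Y₀ Y₃}
    (x : Cell (.two J J') (𝟙 _) (𝟙 _) K) (y : Cell (.two K J'') (𝟙 _) (𝟙 _) H)
    (x' : Cell (.two J' J'') (𝟙 _) (𝟙 _) L) (y' : Cell (.two J L) (𝟙 _) (𝟙 _) H)
    (e : op y x (cid J'') = op y' (cid J) x')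
    (f₀ : X₀ ⟶ Y₀) (f₁ : X₁ ⟶ Y₁) (f₂ : X₂ ⟶ Y₂) (f₃ : X₃ ⟶ Y₃) :
    op (restrOp y f₀ f₂ f₃) (restrOp x f₀ f₁ f₂) (cid (restr J'' f₂ f₃)) =
      op (restrOp y' f₀ f₁ f₃) (cid (restr J f₀ f₁)) (restrOp x' f₁ f₂ f₃) := by
  apply cart_ext _ _ (Category.id_comp _) (Category.id_comp _)
  refine (restrOp_cart y f₀ f₂ f₃ _ _ (Category.id_comp _) (Category.id_comp _)
    (Category.id_comp _)).trans (Eq.trans ?_ (restrOp_cart y' f₀ f₁ f₃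
    (cid (restr J f₀ f₁)) (restrOp x' f₁ f₂ f₃) (Category.id_comp _)
    (Category.id_comp _) (Category.id_comp _)).symm)
  rw [restrOp, restrOp, lift_cart, lift_cart, cid_ccomp, cid_ccomp]
  refine (three_left (cart J f₀ f₁) (cart J' f₁ f₂) (cart J'' f₂ f₃) x y).symm.trans
    (Eq.trans ?_ (three_right (cart J f₀ f₁) (cart J' f₁ f₂) (cart J'' f₂ f₃) x' y'))
  rw [e]

/-- The identity at `f`: the factorization of `unitCell A ∘ f` through the restriction. -/
noncomputable def restrId {X A : E} (f : X ⟶ A) :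
    Cell (.nil X) (𝟙 X) (𝟙 X) (restr (unit A) f f) :=
  lift (𝟙 X) (𝟙 X) (ccomp (.nil f) (unitCell A) (Category.comp_id _) (Category.comp_id _))
    (Category.id_comp _) (Category.id_comp _)

theorem restrId_lunit {X X' A B : E} (K : Pro A B) (f : X ⟶ A) (g : X' ⟶ B) :
    op (restrOp (lunit K) f f g) (restrId f) (cid (restr K f g)) = cid (restr K f g) := by
  apply cart_ext _ _ (Category.id_comp _) (Category.id_comp _)
  refine (restrOp_cart _ _ _ _ _ _ (Category.id_comp _) (Category.id_comp _)
    (Category.id_comp _)).trans ?_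
  rw [restrId, lift_cart, cid_ccomp]
  exact op_lunit _ _

theorem restrId_runit {X X' A B : E} (K : Pro A B) (f : X ⟶ A) (g : X' ⟶ B) :
    op (restrOp (runit K) f g g) (cid (restr K f g)) (restrId g) = cid (restr K f g) := by
  apply cart_ext _ _ (Category.id_comp _) (Category.id_comp _)
  refine (restrOp_cart _ _ _ _ _ _ (Category.id_comp _) (Category.id_comp _)
    (Category.id_comp _)).trans ?_
  rw [restrId, lift_cart, cid_ccomp]
  exact op_runit _ _

end Equipment

/-! ## Categories, profunctors and profunctor morphisms enriched in a virtual double category -/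

/-- Categories enriched in `E`. The object `c` has extent `ext c`. -/
structure EnrichedCat (E : Type u) [VirtualDoubleCategory.{u, v, w, z} E] where
  Obj : Type t
  ext : Obj → E
  hom (a b : Obj) : Pro (ext a) (ext b)
  ident (a : Obj) : Cell (.nil (ext a)) (𝟙 (ext a)) (𝟙 (ext a)) (hom a a)
  mul (a b c : Obj) : Cell (.two (hom a b) (hom b c)) (𝟙 (ext a)) (𝟙 (ext c)) (hom a c)
  ident_mul (a b : Obj) :
    op (mul a a b) (ident a) (cid (hom a b)) = cid (hom a b)
  mul_ident (a b : Obj) :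
    op (mul a b b) (cid (hom a b)) (ident b) = cid (hom a b)
  mul_assoc (a b c d : Obj) :
    op (mul a c d) (mul a b c) (cid (hom c d)) =
      op (mul a b d) (cid (hom a b)) (mul b c d)

/-- Profunctors `C ⇸ D` between categories enriched in `E`, with their left action of `C` and
right action of `D`. -/
structure Profunctor {E : Type u} [VirtualDoubleCategory.{u, v, w, z} E]
    (C : EnrichedCat.{u, v, w, z, t} E) (D : EnrichedCat.{u, v, w, z, t'} E) where
  obj (c : C.Obj) (d : D.Obj) : Pro (C.ext c) (D.ext d)
  actL (c c' : C.Obj) (d : D.Obj) :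
    Cell (.two (C.hom c c') (obj c' d)) (𝟙 (C.ext c)) (𝟙 (D.ext d)) (obj c d)
  actR (c : C.Obj) (d d' : D.Obj) :
    Cell (.two (obj c d) (D.hom d d')) (𝟙 (C.ext c)) (𝟙 (D.ext d')) (obj c d')
  ident_actL (c : C.Obj) (d : D.Obj) :
    op (actL c c d) (C.ident c) (cid (obj c d)) = cid (obj c d)
  mul_actL (c c' c'' : C.Obj) (d : D.Obj) :
    op (actL c c'' d) (C.mul c c' c'') (cid (obj c'' d)) =
      op (actL c c' d) (cid (C.hom c c')) (actL c' c'' d)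
  actR_ident (c : C.Obj) (d : D.Obj) :
    op (actR c d d) (cid (obj c d)) (D.ident d) = cid (obj c d)
  actR_mul (c : C.Obj) (d d' d'' : D.Obj) :
    op (actR c d d'') (cid (obj c d)) (D.mul d d' d'') =
      op (actR c d' d'') (actR c d d') (cid (D.hom d' d''))
  exchange (c c' : C.Obj) (d d' : D.Obj) :
    op (actR c d d') (actL c c' d) (cid (D.hom d d')) =
      op (actL c c' d') (cid (C.hom c c')) (actR c' d d')

namespace Profunctor

section

variable {E : Type u} [VirtualDoubleCategory.{u, v, w, z} E]
  {C : EnrichedCat.{u, v, w, z, t} E} {D : EnrichedCat.{u, v, w, z, t'} E}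

section Elementwise

variable (J : Profunctor C D) {X₀ X₁ X₂ X₃ : E} {Is : ProPath Pro X₀ X₁} {Is' : ProPath Pro X₁ X₂}
  {Is'' : ProPath Pro X₂ X₃}

theorem op_mul_actL (c c' c'' : C.Obj) (d : D.Obj) {h₀ : X₀ ⟶ C.ext c} {h₁ : X₁ ⟶ C.ext c'}
    {h₂ : X₂ ⟶ C.ext c''} {h₃ : X₃ ⟶ D.ext d}
    (a : Cell Is h₀ h₁ (C.hom c c')) (b : Cell Is' h₁ h₂ (C.hom c' c''))
    (x : Cell Is'' h₂ h₃ (J.obj c'' d)) :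
    ccomp (.cons (op (C.mul c c' c'') a b) (.one x) (ProPath.append_assoc _ _ _).symm)
        (J.actL c c'' d) (Category.comp_id _) (Category.comp_id _) =
      op (J.actL c c' d) a (op (J.actL c' c'' d) b x) := by
  rw [← three_left, J.mul_actL, three_right]

theorem op_exchange (c c' : C.Obj) (d d' : D.Obj) {h₀ : X₀ ⟶ C.ext c} {h₁ : X₁ ⟶ C.ext c'}
    {h₂ : X₂ ⟶ D.ext d} {h₃ : X₃ ⟶ D.ext d'}
    (a : Cell Is h₀ h₁ (C.hom c c')) (x : Cell Is' h₁ h₂ (J.obj c' d))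
    (b : Cell Is'' h₂ h₃ (D.hom d d')) :
    ccomp (.cons (op (J.actL c c' d) a x) (.one b) (ProPath.append_assoc _ _ _).symm)
        (J.actR c d d') (Category.comp_id _) (Category.comp_id _) =
      op (J.actL c c' d') a (op (J.actR c' d d') x b) := by
  rw [← three_left, J.exchange, three_right]

theorem op_actR_mul (c : C.Obj) (d d' d'' : D.Obj) {h₀ : X₀ ⟶ C.ext c} {h₁ : X₁ ⟶ D.ext d}
    {h₂ : X₂ ⟶ D.ext d'} {h₃ : X₃ ⟶ D.ext d''}
    (x : Cell Is h₀ h₁ (J.obj c d)) (a : Cell Is' h₁ h₂ (D.hom d d'))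
    (b : Cell Is'' h₂ h₃ (D.hom d' d'')) :
    op (J.actR c d d'') x (op (D.mul d d' d'') a b) =
    ccomp (.cons (op (J.actR c d d') x a) (.one b) (ProPath.append_assoc _ _ _).symm)
        (J.actR c d' d'') (Category.comp_id _) (Category.comp_id _) := by
  rw [← three_left, ← J.actR_mul, three_right]

end Elementwise

/-- Morphisms of profunctors `J → K : C ⇸ D` (with identity functors as vertical sides). -/
@[ext]
structure Hom (J K : Profunctor C D) where
  app (c : C.Obj) (d : D.Obj) :
    Cell (.one (J.obj c d)) (𝟙 (C.ext c)) (𝟙 (D.ext d)) (K.obj c d)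
  app_actL (c c' : C.Obj) (d : D.Obj) :
    ccomp (.one (J.actL c c' d)) (app c d) (ii _) (ii _) =
      ccomp (.two (cid (C.hom c c')) (app c' d)) (K.actL c c' d) (ii _) (ii _)
  app_actR (c : C.Obj) (d d' : D.Obj) :
    ccomp (.one (J.actR c d d')) (app c d') (ii _) (ii _) =
      ccomp (.two (app c d) (cid (D.hom d d'))) (K.actR c d d') (ii _) (ii _)

/-- The identity morphism has identity components. -/
def Hom.id (J : Profunctor C D) : Hom J J where
  app c d := cid (J.obj c d)
  app_actL _ _ _ := (ccomp_cid _).trans (idPath_ccomp _).symm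
  app_actR _ _ _ := (ccomp_cid _).trans (idPath_ccomp _).symm

/-- Morphisms of profunctors are composed componentwise. -/
def Hom.comp {J K L : Profunctor C D} (φ : Hom J K) (ψ : Hom K L) : Hom J L where
  app c d := ccomp (.one (φ.app c d)) (ψ.app c d) (ii _) (ii _)
  app_actL c c' d := by
    rw [← ccomp_one _ _ _ (ii _) (ii _) (ii _) (ii _), φ.app_actL,
      ccomp_one _ _ _ _ _ _ _ (ii _) (ii _) (ii _) (ii _), ψ.app_actL]
    rw [two_two _ _ _ _ _ _ _ _ _ (ii _) (ii _) (ii _) (ii _) (ii _), cid_ccomp]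
  app_actR c d d' := by
    rw [← ccomp_one _ _ _ (ii _) (ii _) (ii _) (ii _), φ.app_actR,
      ccomp_one _ _ _ _ _ _ _ (ii _) (ii _) (ii _) (ii _), ψ.app_actR]
    rw [two_two _ _ _ _ _ _ _ _ _ (ii _) (ii _) (ii _) (ii _) (ii _), cid_ccomp]

/-- The category of profunctors `C ⇸ D`. -/
instance : Category (Profunctor C D) where
  Hom := Hom
  id := Hom.id
  comp := Hom.comp
  id_comp φ := by
    apply Hom.ext; funext c d; exact cid_ccomp _ _ _
  comp_id φ := by
    apply Hom.ext; funext c d; exact ccomp_cid _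
  assoc φ ψ χ := by
    apply Hom.ext; funext c d; exact ccomp_one _ _ _ _ _ _ _ _ _ _ _

end

end Profunctor

/-- The category of proarrows `A ⇸ B`, with the globular unary 2-cells as morphisms. -/
instance {E : Type u} [VirtualDoubleCategory.{u, v, w, z} E] (A B : E) :
    Category (Pro A B) where
  Hom J K := Cell (.one J) (𝟙 A) (𝟙 B) K
  id J := cid J
  comp φ ψ := ccomp (.one φ) ψ (ii _) (ii _)
  id_comp _ := cid_ccomp _ _ _
  comp_id _ := ccomp_cid _
  assoc _ _ _ := ccomp_one _ _ _ _ _ _ _ _ _ _ _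


/-! ## The canonical embedding -/

section Realize

variable {E : Type u} [VirtualEquipment.{u, v, w, z} E]

/-- The objects of `|A|`: vertical arrows into `A`. -/
structure Elem (A : E) where
  dom : E
  arr : dom ⟶ A

/-- The element `id_A` of `|A|`. -/
abbrev Elem.idElem (A : E) : Elem A := ⟨A, 𝟙 A⟩

/-- The `E`-enriched category `|A|`: its objects are the vertical arrows into `A`, the extent of
`f` is its domain, the hom-proarrow from `f` to `g` is `(unit A)(f, g)` (equivalently the composite
of the companion of `f` with the conjoint of `g`). -/
noncomputable abbrev realize (A : E) : EnrichedCat.{u, v, w, z, max u v} E where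
  Obj := Elem A
  ext := Elem.dom
  hom f g := restr (unit A) f.arr g.arr
  ident f := restrId f.arr
  mul f g h := restrOp (lunit (unit A)) f.arr g.arr h.arr
  ident_mul f g := restrId_lunit _ _ _
  mul_ident f g := by rw [← runit_unit]; exact restrId_runit _ _ _
  mul_assoc f g h k := restrOp_assoc _ _ _ _ (lunit_assoc _) _ _ _ _

/-- The profunctor `|K| : |A| ⇸ |B|` of a proarrow `K : A ⇸ B`, with components `K(f, g)`. -/
noncomputable abbrev realizePro {A B : E} (K : Pro A B) : Profunctor (realize A) (realize B) where
  obj f g := restr K f.arr g.arr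
  actL f f' g := restrOp (lunit K) f.arr f'.arr g.arr
  actR f g g' := restrOp (runit K) f.arr g.arr g'.arr
  ident_actL _ _ := restrId_lunit _ _ _
  mul_actL _ _ _ _ := restrOp_assoc _ _ _ _ (lunit_assoc _) _ _ _ _
  actR_ident _ _ := restrId_runit _ _ _
  actR_mul _ _ _ _ := (restrOp_assoc _ _ _ _ (runit_assoc _).symm _ _ _ _).symm
  exchange _ _ _ _ := restrOp_assoc _ _ _ _ (lunit_runit _) _ _ _ _

/-- The restriction of a globular unary 2-cell along vertical arrows. -/
noncomputable def restrMap {X Y A B : E} {K K' : Pro A B} (φ : Cell (.one K) (𝟙 A) (𝟙 B) K')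
    (f : X ⟶ A) (g : Y ⟶ B) : Cell (.one (restr K f g)) (𝟙 X) (𝟙 Y) (restr K' f g) :=
  lift (𝟙 X) (𝟙 Y) (ccomp (.one (cart K f g)) φ (Category.comp_id _) (Category.comp_id _))
    (Category.id_comp _) (Category.id_comp _)

theorem restrMap_cart {X Y A B Z W : E} {K K' : Pro A B} (φ : Cell (.one K) (𝟙 A) (𝟙 B) K')
    (f : X ⟶ A) (g : Y ⟶ B) {Is : ProPath Pro Z W} {h : Z ⟶ X} {k : W ⟶ Y} {l : Z ⟶ A} {m : W ⟶ B}
    (a : Cell Is h k (restr K f g)) (p : h ≫ f = l) (q : k ≫ g = m) :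
    ccomp (.one (ccomp (.one a) (restrMap φ f g) (Category.comp_id _) (Category.comp_id _)))
      (cart K' f g) p q =
    ccomp (.one (ccomp (.one a) (cart K f g) p q)) φ (Category.comp_id _) (Category.comp_id _) := by
  rw [ccomp_one _ _ _ _ _ _ _ (Category.id_comp _) (Category.id_comp _) p q, restrMap, lift_cart,
    ccomp_one]

theorem restrMap_lunit {X X' Y A B : E} {K K' : Pro A B} (φ : Cell (.one K) (𝟙 A) (𝟙 B) K')
    (f : X ⟶ A) (f' : X' ⟶ A) (g : Y ⟶ B) :
    ccomp (.one (restrOp (lunit K) f f' g)) (restrMap φ f g) (ii _) (ii _) =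
      op (restrOp (lunit K') f f' g) (cid (restr (unit A) f f')) (restrMap φ f' g) := by
  apply cart_ext _ _ (Category.id_comp _) (Category.id_comp _)
  refine (restrMap_cart φ f g _ _ _).trans (Eq.trans ?_ (restrOp_cart (lunit K')
    f f' g (cid (restr (unit A) f f')) (restrMap φ f' g)
    (Category.id_comp _) (Category.id_comp _) (Category.id_comp _)).symm)
  rw [restrMap, lift_cart, cid_ccomp, restrOp, lift_cart]
  refine (ccomp_one _ _ _ _ _ _ _ (ii _) (ii _) (Category.comp_id _)
    (Category.comp_id _)).trans ?_
  rw [lunit_natural]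
  refine (two_two _ _ _ _ _ _ _ _ _ (Category.comp_id _) (Category.comp_id _)
    (Category.comp_id _) (Category.comp_id _) (Category.comp_id _)).trans ?_
  rw [ccomp_cid]

theorem restrMap_runit {X Y Y' A B : E} {K K' : Pro A B} (φ : Cell (.one K) (𝟙 A) (𝟙 B) K')
    (f : X ⟶ A) (g : Y ⟶ B) (g' : Y' ⟶ B) :
    ccomp (.one (restrOp (runit K) f g g')) (restrMap φ f g') (ii _) (ii _) =
      op (restrOp (runit K') f g g') (restrMap φ f g) (cid (restr (unit B) g g')) := by
  apply cart_ext _ _ (Category.id_comp _) (Category.id_comp _)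
  refine (restrMap_cart φ f g' _ _ _).trans (Eq.trans ?_ (restrOp_cart (runit K')
    f g g' (restrMap φ f g) (cid (restr (unit B) g g'))
    (Category.id_comp _) (Category.id_comp _) (Category.id_comp _)).symm)
  rw [restrMap, lift_cart, cid_ccomp, restrOp, lift_cart]
  refine (ccomp_one _ _ _ _ _ _ _ (ii _) (ii _) (Category.comp_id _)
    (Category.comp_id _)).trans ?_
  rw [runit_natural]
  refine (two_two _ _ _ _ _ _ _ _ _ (Category.comp_id _) (Category.comp_id _)
    (Category.comp_id _) (Category.comp_id _) (Category.comp_id _)).trans ?_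
  rw [ccomp_cid]

/-- The morphism of profunctors `|φ| : |K| → |K'|`. -/
noncomputable def realizeMap {A B : E} {K K' : Pro A B} (φ : K ⟶ K') :
    realizePro K ⟶ realizePro K' where
  app f g := restrMap φ f.arr g.arr
  app_actL _ _ _ := restrMap_lunit _ _ _ _
  app_actR _ _ _ := restrMap_runit _ _ _ _

/-- The canonical embedding on proarrows, as a functor from the category of proarrows `A ⇸ B` to
the category of profunctors `|A| ⇸ |B|`. -/
noncomputable def realizeFunctor (A B : E) : Pro A B ⥤ Profunctor (realize A) (realize B) where
  obj := realizePro
  map := realizeMap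
  map_id K := by
    apply Profunctor.Hom.ext
    funext f g
    apply cart_ext _ _ (Category.id_comp _) (Category.id_comp _)
    exact (lift_cart _ _ _ _ _).trans ((ccomp_cid _).trans (cid_ccomp _ _ _).symm)
  map_comp {K K' K''} φ ψ := by
    apply Profunctor.Hom.ext
    funext f g
    apply cart_ext _ _ (Category.id_comp _) (Category.id_comp _)
    refine (lift_cart _ _ _ _ _).trans (Eq.trans ?_ (restrMap_cart ψ f.arr g.arr
      (restrMap φ f.arr g.arr) (Category.id_comp _) (Category.id_comp _)).symm)
    rw [restrMap, lift_cart]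
    exact (ccomp_one _ _ _ _ _ _ _ _ _ _ _).symm

/-! ### The canonical action morphism -/

/-- The binding 2-cell of the companion `(unit A)(f, id_A)` of `f`. -/
noncomputable def companionCell {X A : E} (f : X ⟶ A) :
    Cell (.nil X) (𝟙 X) f (restr (unit A) f (𝟙 A)) :=
  lift (𝟙 X) f (ccomp (.nil f) (unitCell A) (Category.comp_id _) (Category.comp_id _))
    (Category.id_comp _) (Category.comp_id _)

/-- The binding 2-cell of the conjoint `(unit B)(id_B, g)` of `g`. -/
noncomputable def conjointCell {Y B : E} (g : Y ⟶ B) :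
    Cell (.nil Y) g (𝟙 Y) (restr (unit B) (𝟙 B) g) :=
  lift g (𝟙 Y) (ccomp (.nil g) (unitCell B) (Category.comp_id _) (Category.comp_id _))
    (Category.comp_id _) (Category.id_comp _)

/-- The factorization of `unit A` through its restriction along identities, precomposed with a
cartesian 2-cell. -/
noncomputable def straighten {X Y A : E} (f : X ⟶ A) (g : Y ⟶ A) :
    Cell (.one (restr (unit A) f g)) f g (restr (unit A) (𝟙 A) (𝟙 A)) :=
  lift f g (cart (unit A) f g) (Category.comp_id _) (Category.comp_id _)

theorem companion_straighten {X Y A : E} (f : X ⟶ A) (g : Y ⟶ A) :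
    op (restrOp (lunit (unit A)) f (𝟙 A) (𝟙 A)) (companionCell f) (straighten f g) =
      op (restrOp (lunit (unit A)) f g (𝟙 A)) (cid (restr (unit A) f g)) (companionCell g) := by
  apply cart_ext _ _ (Category.id_comp _) (Category.comp_id _)
  refine (restrOp_cart _ _ _ _ _ _ (Category.id_comp _) (Category.comp_id _)
    (Category.comp_id _)).trans (Eq.trans ?_ (restrOp_cart _ f g (𝟙 A)
    (cid (restr (unit A) f g)) (companionCell g) (Category.id_comp _)
    (Category.id_comp _) (Category.comp_id _)).symm)
  rw [companionCell, companionCell, straighten, lift_cart, lift_cart, lift_cart, cid_ccomp]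
  refine (op_lunit _ _).trans ?_
  rw [← runit_unit]
  exact (op_runit _ _).symm

theorem straighten_conjoint {X Y A : E} (f : X ⟶ A) (g : Y ⟶ A) :
    op (restrOp (lunit (unit A)) (𝟙 A) (𝟙 A) g) (straighten f g) (conjointCell g) =
      op (restrOp (lunit (unit A)) (𝟙 A) f g) (conjointCell f) (cid (restr (unit A) f g)) := by
  apply cart_ext _ _ (Category.comp_id _) (Category.id_comp _)
  refine (restrOp_cart _ _ _ _ _ _ (Category.comp_id _) (Category.comp_id _)
    (Category.id_comp _)).trans (Eq.trans ?_ (restrOp_cart _ (𝟙 A) f g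
    (conjointCell f) (cid (restr (unit A) f g)) (Category.comp_id _)
    (Category.id_comp _) (Category.id_comp _)).symm)
  rw [conjointCell, conjointCell, straighten, lift_cart, lift_cart, lift_cart, cid_ccomp]
  refine Eq.trans ?_ (op_lunit _ _).symm
  rw [← runit_unit]
  exact op_runit _ _

/-- The canonical 2-cell from `unit A` to its restriction along identities. -/
noncomputable def unitToRestr (A : E) :
    Cell (.one (unit A)) (𝟙 A) (𝟙 A) (restr (unit A) (𝟙 A) (𝟙 A)) :=
  lift (𝟙 A) (𝟙 A) (cid (unit A)) (ii _) (ii _)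

theorem cart_unitToRestr {X Y A : E} (f : X ⟶ A) (g : Y ⟶ A) :
    ccomp (.one (cart (unit A) f g)) (unitToRestr A) (Category.comp_id _) (Category.comp_id _) =
      straighten f g := by
  apply cart_ext _ _ (Category.comp_id _) (Category.comp_id _)
  rw [ccomp_one _ _ _ _ _ _ _ (ii _) (ii _) (Category.comp_id _) (Category.comp_id _),
    unitToRestr, lift_cart, straighten, lift_cart, ccomp_cid]

theorem unitCell_unitToRestr (A : E) :
    ccomp (.one (unitCell A)) (unitToRestr A) (ii _) (ii _) = restrId (𝟙 A) := by
  apply cart_ext _ _ (ii _) (ii _)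
  rw [ccomp_one _ _ _ _ _ _ _ (ii _) (ii _) (ii _) (ii _),
    unitToRestr, lift_cart, restrId, lift_cart, ccomp_cid, nil_ccomp]

section Action

variable {A B : E} (J : Profunctor (realize A) (realize B))

/-- The component `J(id_A, id_B) : A ⇸ B` of a profunctor `J : |A| ⇸ |B|`. -/
abbrev atId : Pro A B := J.obj (.idElem A) (.idElem B)

theorem op_lunit_atId {X X' Y : E} {Is : ProPath Pro X X'} {Is' : ProPath Pro X' Y}
    {f : X ⟶ A} {g : X' ⟶ A} {h : Y ⟶ B} (a : Cell Is f g (unit A)) (b : Cell Is' g h (atId J)) :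
    op (lunit (atId J)) a b = op (J.actL (.idElem A) (.idElem A) (.idElem B))
      (ccomp (.one a) (unitToRestr A) (Category.comp_id _) (Category.comp_id _)) b := by
  have h : lunit (atId J) = op (J.actL (.idElem A) (.idElem A) (.idElem B))
      (unitToRestr A) (cid (atId J)) := by
    apply unit_extL (Qs := .one (atId J))
    refine (unit_lunit _).trans (Eq.trans ?_ (two_two (unitCell A) (unitToRestr A)
      (cid (atId J)) (cid (atId J)) (J.actL (.idElem A) (.idElem A) (.idElem B))
      (ii _) (ii _) (ii _) (ii _) (ii _) (ii _) (ii _) (ii _) (ii _)).symm)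
    rw [unitCell_unitToRestr, cid_ccomp]
    exact (J.ident_actL (.idElem A) (.idElem B)).symm
  rw [h]
  refine (two_two _ _ _ _ _ _ _ _ _ (Category.comp_id _) (Category.comp_id _)
    (Category.comp_id _) (Category.comp_id _) (Category.comp_id _)).trans ?_
  rw [ccomp_cid]

theorem op_runit_atId {X Y Y' : E} {Is : ProPath Pro X Y} {Is' : ProPath Pro Y Y'}
    {f : X ⟶ A} {g : Y ⟶ B} {h : Y' ⟶ B} (a : Cell Is f g (atId J)) (b : Cell Is' g h (unit B)) :
    op (runit (atId J)) a b = op (J.actR (.idElem A) (.idElem B) (.idElem B)) a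
      (ccomp (.one b) (unitToRestr B) (Category.comp_id _) (Category.comp_id _)) := by
  have h : runit (atId J) = op (J.actR (.idElem A) (.idElem B) (.idElem B))
      (cid (atId J)) (unitToRestr B) := by
    apply unit_extR (Ks := .one (atId J))
    refine (unit_runit _).trans (Eq.trans ?_ (two_two (cid (atId J)) (cid (atId J))
      (unitCell B) (unitToRestr B) (J.actR (.idElem A) (.idElem B) (.idElem B))
      (ii _) (ii _) (ii _) (ii _) (ii _) (ii _) (ii _) (ii _) (ii _)).symm)
    rw [unitCell_unitToRestr, cid_ccomp]
    exact (J.actR_ident (.idElem A) (.idElem B)).symm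
  rw [h]
  refine (two_two _ _ _ _ _ _ _ _ _ (Category.comp_id _) (Category.comp_id _)
    (Category.comp_id _) (Category.comp_id _) (Category.comp_id _)).trans ?_
  rw [ccomp_cid]

/-- The left action of `(unit A)(f, id_A)` on `J(id_A, id_B)`, restricted along `f` and `g`. -/
noncomputable def actionLeft {X Y : E} (f : X ⟶ A) (g : Y ⟶ B) :
    Cell (.one (restr (atId J) f g)) (𝟙 X) g (J.obj ⟨X, f⟩ (.idElem B)) :=
  op (J.actL ⟨X, f⟩ (.idElem A) (.idElem B)) (companionCell f) (cart (atId J) f g)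

/-- The component at `f : X ⟶ A`, `g : Y ⟶ B` of the canonical action morphism: the 2-cell
`J(id_A, id_B)(f, g) → J(f, g)` that is given by the actions of the companion `(unit A)(f, id_A)`
of `f` and of the conjoint `(unit B)(id_B, g)` of `g` on `J(id_A, id_B)`. -/
noncomputable def actionApp {X Y : E} (f : X ⟶ A) (g : Y ⟶ B) :
    Cell (.one (restr (atId J) f g)) (𝟙 X) (𝟙 Y) (J.obj ⟨X, f⟩ ⟨Y, g⟩) :=
  op (J.actR ⟨X, f⟩ (.idElem B) ⟨Y, g⟩) (actionLeft J f g) (conjointCell g)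

theorem actionLeft_lunit {X X' Y : E} (f : X ⟶ A) (f' : X' ⟶ A) (g : Y ⟶ B) :
    ccomp (.one (restrOp (lunit (atId J)) f f' g)) (actionLeft J f g) (ii _)
        (Category.id_comp _) =
      op (J.actL ⟨X, f⟩ ⟨X', f'⟩ (.idElem B)) (cid (restr (unit A) f f')) (actionLeft J f' g) := by
  have h := ccomp_two (.nil (𝟙 X)) (companionCell f) (.one (restrOp (lunit (atId J)) f f' g))
    (cart (atId J) f g) (J.actL ⟨X, f⟩ (.idElem A) (.idElem B))
    (ii _) (Category.id_comp _) (Category.id_comp _) (ii _) (Category.comp_id _)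
    (ii _) (Category.comp_id _) (ii _) (Category.id_comp _)
  rw [nil_ccomp, restrOp, lift_cart] at h
  refine h.symm.trans ?_
  rw [op_lunit_atId, cart_unitToRestr]
  refine (J.op_mul_actL ⟨X, f⟩ (.idElem A) (.idElem A) (.idElem B)
    (companionCell f) (straighten f f')
    (cart (atId J) f' g)).symm.trans ?_
  refine Eq.trans ?_ (J.op_mul_actL ⟨X, f⟩ ⟨X', f'⟩ (.idElem A) (.idElem B)
    (cid (restr (unit A) f f')) (companionCell f')
    (cart (atId J) f' g))
  exact congrArg (fun t => op (J.actL ⟨X, f⟩ (.idElem A) (.idElem B)) t (cart (atId J) f' g))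
    (companion_straighten f f')

theorem actionApp_lunit {X X' Y : E} (f : X ⟶ A) (f' : X' ⟶ A) (g : Y ⟶ B) :
    ccomp (.one (restrOp (lunit (atId J)) f f' g)) (actionApp J f g) (ii _) (ii _) =
      op (J.actL ⟨X, f⟩ ⟨X', f'⟩ ⟨Y, g⟩) (cid (restr (unit A) f f')) (actionApp J f' g) := by
  have h := ccomp_two (.one (restrOp (lunit (atId J)) f f' g)) (actionLeft J f g) (.nil (𝟙 Y))
    (conjointCell g) (J.actR ⟨X, f⟩ (.idElem B) ⟨Y, g⟩)
    (ii _) (Category.id_comp _) (ii _) (ii _) (ii _) (ii _) (ii _) (ii _) (ii _)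
  rw [nil_ccomp, actionLeft_lunit] at h
  exact h.symm.trans (J.op_exchange ⟨X, f⟩ ⟨X', f'⟩ (.idElem B) ⟨Y, g⟩
    (cid (restr (unit A) f f')) (actionLeft J f' g)
    (conjointCell g))

theorem actionLeft_runit {X Y Y' : E} (f : X ⟶ A) (g : Y ⟶ B) (g' : Y' ⟶ B) :
    ccomp (.one (restrOp (runit (atId J)) f g g')) (actionLeft J f g') (ii _)
        (Category.id_comp _) =
      op (J.actR ⟨X, f⟩ (.idElem B) (.idElem B)) (actionLeft J f g) (straighten g g') := by
  have h := ccomp_two (.nil (𝟙 X)) (companionCell f) (.one (restrOp (runit (atId J)) f g g'))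
    (cart (atId J) f g') (J.actL ⟨X, f⟩ (.idElem A) (.idElem B))
    (ii _) (Category.id_comp _) (Category.id_comp _) (ii _) (Category.comp_id _)
    (ii _) (Category.comp_id _) (ii _) (Category.id_comp _)
  rw [nil_ccomp, restrOp, lift_cart] at h
  refine h.symm.trans ?_
  rw [op_runit_atId, cart_unitToRestr]
  exact (J.op_exchange ⟨X, f⟩ (.idElem A) (.idElem B) (.idElem B)
    (companionCell f) (cart (atId J) f g) (straighten g g')).symm

theorem actionApp_runit {X Y Y' : E} (f : X ⟶ A) (g : Y ⟶ B) (g' : Y' ⟶ B) :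
    ccomp (.one (restrOp (runit (atId J)) f g g')) (actionApp J f g') (ii _) (ii _) =
      op (J.actR ⟨X, f⟩ ⟨Y, g⟩ ⟨Y', g'⟩) (actionApp J f g) (cid (restr (unit B) g g')) := by
  have h := ccomp_two (.one (restrOp (runit (atId J)) f g g')) (actionLeft J f g') (.nil (𝟙 Y'))
    (conjointCell g') (J.actR ⟨X, f⟩ (.idElem B) ⟨Y', g'⟩)
    (ii _) (Category.id_comp _) (ii _) (ii _) (ii _) (ii _) (ii _) (ii _) (ii _)
  rw [nil_ccomp, actionLeft_runit] at h
  refine h.symm.trans ?_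
  refine (J.op_actR_mul ⟨X, f⟩ (.idElem B) (.idElem B) ⟨Y', g'⟩
    (actionLeft J f g) (straighten g g') (conjointCell g')).symm.trans
    ?_
  refine Eq.trans ?_ (J.op_actR_mul ⟨X, f⟩ (.idElem B) ⟨Y, g⟩ ⟨Y', g'⟩
    (actionLeft J f g) (conjointCell g)
    (cid (restr (unit B) g g')))
  exact congrArg (fun t => op (J.actR ⟨X, f⟩ (.idElem B) ⟨Y', g'⟩) (actionLeft J f g) t)
    (straighten_conjoint g g')

/-- The canonical action morphism `|J(id_A, id_B)| → J`. -/
noncomputable def actionMorphism : realizePro (J.obj (.idElem A) (.idElem B)) ⟶ J where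
  app f g := actionApp J f.arr g.arr
  app_actL f f' g := actionApp_lunit J f.arr f'.arr g.arr
  app_actR f g g' := actionApp_runit J f.arr g.arr g'.arr

end Action

end Realize

end VirtualDouble

/-!
The canonical action morphism `|J(id, id)| → J` is natural in `J`
(`actionMorphism_naturality`), because the components of a morphism of profunctors commute with
both actions. Invertibility of the action morphism is therefore invariant under isomorphism of
profunctors, and it is enough to show that it holds for `J = |K|`.

For `J = |K|` the action morphism is the image under `|·|` of the cartesian 2-cell
`K(id, id) → K` (`actionMorphism_realizePro`): after composition with the cartesian 2-cell
`K(f, g) → K`, the companion and the conjoint in the definition of the action become units, which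
act trivially on `K`. The cartesian 2-cell `K(id, id) → K` is invertible, since it lies over
identities (`isIso_cart_id`).

Conversely, an invertible action morphism is itself an isomorphism from an object `|J(id, id)|` in
the image of `|·|` to `J`.
-/

namespace VirtualDouble

open CellData (Pro Cell)
open CompData (cid ccomp)
open VirtualDoubleCategory (ccomp_cid)
open VirtualEquipment (restr cart)

namespace Profunctor

variable {E : Type u} [VirtualDoubleCategory.{u, v, w, z} E]
  {C : EnrichedCat.{u, v, w, z, t} E} {D : EnrichedCat.{u, v, w, z, t'} E}
  {J J' : Profunctor C D} {X₀ X₁ X₂ : E} {Is : ProPath Pro X₀ X₁} {Is' : ProPath Pro X₁ X₂}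

theorem Hom.op_actL_app (φ : Hom J J') (c c' : C.Obj) (d : D.Obj) {h₀ : X₀ ⟶ C.ext c}
    {h₁ : X₁ ⟶ C.ext c'} {h₂ : X₂ ⟶ D.ext d} (a : Cell Is h₀ h₁ (C.hom c c'))
    (x : Cell Is' h₁ h₂ (J.obj c' d)) :
    ccomp (.one (op (J.actL c c' d) a x)) (φ.app c d) (Category.comp_id _) (Category.comp_id _) =
      op (J'.actL c c' d) a
        (ccomp (.one x) (φ.app c' d) (Category.comp_id _) (Category.comp_id _)) := by
  rw [op, ccomp_one _ _ _ _ _ _ _ (ii _) (ii _) (Category.comp_id _) (Category.comp_id _),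
    φ.app_actL]
  refine (two_two _ _ _ _ _ _ _ _ _ (Category.comp_id _) (Category.comp_id _)
    (Category.comp_id _) (Category.comp_id _) (Category.comp_id _)).trans ?_
  rw [ccomp_cid]

theorem Hom.op_actR_app (φ : Hom J J') (c : C.Obj) (d d' : D.Obj) {h₀ : X₀ ⟶ C.ext c}
    {h₁ : X₁ ⟶ D.ext d} {h₂ : X₂ ⟶ D.ext d'} (x : Cell Is h₀ h₁ (J.obj c d))
    (b : Cell Is' h₁ h₂ (D.hom d d')) :
    ccomp (.one (op (J.actR c d d') x b)) (φ.app c d') (Category.comp_id _) (Category.comp_id _) =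
      op (J'.actR c d d')
        (ccomp (.one x) (φ.app c d) (Category.comp_id _) (Category.comp_id _)) b := by
  rw [op, ccomp_one _ _ _ _ _ _ _ (ii _) (ii _) (Category.comp_id _) (Category.comp_id _),
    φ.app_actR]
  refine (two_two _ _ _ _ _ _ _ _ _ (Category.comp_id _) (Category.comp_id _)
    (Category.comp_id _) (Category.comp_id _) (Category.comp_id _)).trans ?_
  rw [ccomp_cid]

end Profunctor

variable {E : Type u} [VirtualEquipment.{u, v, w, z} E] {A B : E}

section Naturality

variable {J J' : Profunctor (realize A) (realize B)}

theorem actionLeft_app (φ : Profunctor.Hom J J') {X Y : E} (f : X ⟶ A) (g : Y ⟶ B) :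
    ccomp (.one (actionLeft J f g)) (φ.app ⟨X, f⟩ (.idElem B)) (ii _) (Category.comp_id _) =
      ccomp (.one (restrMap (φ.app (.idElem A) (.idElem B)) f g)) (actionLeft J' f g) (ii _)
        (Category.id_comp _) := by
  have h := ccomp_two (.nil (𝟙 X)) (companionCell f)
    (.one (restrMap (φ.app (.idElem A) (.idElem B)) f g))
    (cart (atId J') f g) (J'.actL ⟨X, f⟩ (.idElem A) (.idElem B))
    (ii _) (Category.id_comp _) (Category.id_comp _) (ii _) (Category.comp_id _)
    (ii _) (Category.comp_id _) (ii _) (Category.id_comp _)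
  rw [nil_ccomp, restrMap, lift_cart] at h
  exact (φ.op_actL_app ⟨X, f⟩ (.idElem A) (.idElem B) (companionCell f)
    (cart (atId J) f g)).trans h

theorem actionApp_app (φ : Profunctor.Hom J J') {X Y : E} (f : X ⟶ A) (g : Y ⟶ B) :
    ccomp (.one (actionApp J f g)) (φ.app ⟨X, f⟩ ⟨Y, g⟩) (ii _) (ii _) =
      ccomp (.one (restrMap (φ.app (.idElem A) (.idElem B)) f g)) (actionApp J' f g) (ii _)
        (ii _) := by
  have h := ccomp_two (.one (restrMap (φ.app (.idElem A) (.idElem B)) f g)) (actionLeft J' f g)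
    (.nil (𝟙 Y)) (conjointCell g) (J'.actR ⟨X, f⟩ (.idElem B) ⟨Y, g⟩)
    (ii _) (Category.id_comp _) (ii _) (ii _) (ii _) (ii _) (ii _) (ii _) (ii _)
  rw [nil_ccomp, ← actionLeft_app] at h
  exact (φ.op_actR_app ⟨X, f⟩ (.idElem B) ⟨Y, g⟩ (actionLeft J f g) (conjointCell g)).trans h

theorem actionMorphism_naturality (φ : J ⟶ J') :
    actionMorphism J ≫ φ =
      (realizeFunctor A B).map (Profunctor.Hom.app φ (.idElem A) (.idElem B)) ≫
        actionMorphism J' := by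
  apply Profunctor.Hom.ext
  funext f g
  exact actionApp_app φ f.arr g.arr

end Naturality

/-- The cartesian 2-cell `K(id, id) → K`, as a morphism of the category of proarrows. -/
noncomputable abbrev cartId (K : Pro A B) : restr K (𝟙 A) (𝟙 B) ⟶ K :=
  cart K (𝟙 A) (𝟙 B)

theorem isIso_cart_id (K : Pro A B) : IsIso (cartId K) := by
  have h : ccomp (.one (lift (𝟙 A) (𝟙 B) (cid K) (ii _) (ii _))) (cart K (𝟙 A) (𝟙 B))
      (ii _) (ii _) = cid K := lift_cart _ _ _ _ _
  refine ⟨lift (𝟙 A) (𝟙 B) (cid K) (ii _) (ii _), ?_, h⟩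
  -- Both endomorphisms of `K(id, id)` have the same composite with the cartesian 2-cell.
  apply cart_ext _ _ (ii _) (ii _)
  refine (ccomp_one _ _ _ _ _ _ _ (ii _) (ii _) (ii _) (ii _)).trans ?_
  rw [h]
  exact (ccomp_cid _).trans (cid_ccomp _ _ _).symm

theorem actionLeft_realizePro_cart (K : Pro A B) {X Y : E} (f : X ⟶ A) (g : Y ⟶ B) :
    ccomp (.one (actionLeft (realizePro K) f g)) (cart K f (𝟙 B)) (Category.id_comp _)
        (Category.comp_id _) =
      ccomp (.one (cart (restr K (𝟙 A) (𝟙 B)) f g)) (cart K (𝟙 A) (𝟙 B)) (Category.comp_id _)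
        (Category.comp_id _) := by
  refine (restrOp_cart (lunit K) f (𝟙 A) (𝟙 B) (companionCell f)
    (cart (restr K (𝟙 A) (𝟙 B)) f g) (Category.id_comp _) (Category.comp_id _)
    (Category.comp_id _)).trans ?_
  rw [companionCell, lift_cart]
  exact op_lunit _ _

theorem actionApp_realizePro (K : Pro A B) {X Y : E} (f : X ⟶ A) (g : Y ⟶ B) :
    actionApp (realizePro K) f g = restrMap (cart K (𝟙 A) (𝟙 B)) f g := by
  apply cart_ext _ _ (Category.id_comp _) (Category.id_comp _)
  refine (restrOp_cart (runit K) f (𝟙 B) g (actionLeft (realizePro K) f g) (conjointCell g)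
    (Category.id_comp _) (Category.comp_id _) (Category.id_comp _)).trans ?_
  rw [conjointCell, lift_cart, actionLeft_realizePro_cart, restrMap, lift_cart]
  exact op_runit _ _

theorem actionMorphism_realizePro (K : Pro A B) :
    actionMorphism (realizePro K) = (realizeFunctor A B).map (cartId K) := by
  apply Profunctor.Hom.ext
  funext f g
  exact actionApp_realizePro K f.arr g.arr

theorem isIso_actionMorphism_of_iso {J J' : Profunctor (realize A) (realize B)} (i : J ≅ J')
    [hJ : IsIso (actionMorphism J)] : IsIso (actionMorphism J') := by
  -- `i` restricts to an isomorphism `J(id, id) ≅ J'(id, id)`.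
  let j : atId J ≅ atId J' :=
    { hom := Profunctor.Hom.app i.hom (.idElem A) (.idElem B)
      inv := Profunctor.Hom.app i.inv (.idElem A) (.idElem B)
      hom_inv_id := congrArg (fun φ : J ⟶ J => Profunctor.Hom.app φ (.idElem A) (.idElem B))
        i.hom_inv_id
      inv_hom_id := congrArg (fun φ : J' ⟶ J' => Profunctor.Hom.app φ (.idElem A) (.idElem B))
        i.inv_hom_id }
  have h : actionMorphism J' = ((realizeFunctor A B).mapIso j).inv ≫ actionMorphism J ≫ i.hom :=
    (Iso.eq_inv_comp _).2 (actionMorphism_naturality i.hom).symm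
  rw [h]
  exact IsIso.comp_isIso' (Iso.isIso_inv _) (IsIso.comp_isIso' hJ (Iso.isIso_hom i))

end VirtualDouble

theorem mainTheorem5 {E : Type u} [VirtualDouble.VirtualEquipment.{u, v, w, z} E] (A B : E)
    (J : VirtualDouble.Profunctor (VirtualDouble.realize A) (VirtualDouble.realize B)) :
    (VirtualDouble.realizeFunctor A B).essImage J ↔
      IsIso (VirtualDouble.actionMorphism J) := by
  constructor
  · rintro ⟨K, ⟨i⟩⟩
    have hK : IsIso (VirtualDouble.actionMorphism (VirtualDouble.realizePro K)) := by
      rw [VirtualDouble.actionMorphism_realizePro]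
      have := VirtualDouble.isIso_cart_id K
      exact Functor.map_isIso _ _
    exact VirtualDouble.isIso_actionMorphism_of_iso (hJ := hK) i
  · intro h
    exact ⟨_, ⟨@asIso _ _ _ _ (VirtualDouble.actionMorphism J) h⟩⟩
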